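/- Let $K$ be a number field of degree $n=[K:\mathbb{Q}]$ and let $L/K$ be a cyclic Galois extension of degree $d=[L:K]$ with $\mathrm{Gal}(L/K)=\langle\theta\rangle$. Let $\gamma\in\mathcal{O}_K$ be non-zero and let $$\mathcal{A}=(L/K,\theta,\gamma)=L\oplus uL\oplus\dots\oplus u^{d-1}L,\qquad xu=u\,\theta(x)\ (x\in L),\qquad u^d=\gamma,$$ be the associated cyclic algebra, with natural order $\Lambda=\mathcal{O}_L\oplus u\mathcal{O}_L\oplus\dots\oplus u^{d-1}\mathcal{O}_L$. Let $q$ be a prime number that splits completely in $K$, that is, $q\mathcal{O}_K=\mathfrak{q}_1\cdots\mathfrak{q}_n$ with pairwise distinct prime ideals $\mathfrak{q}_i$ of $\mathcal{O}_K$, and suppose $q\ge n+1$. Then the ring $\Lambda_q=\Lambda/q\Lambda$ is finite, and the proportion of its elements that are invertible satisfies $$\frac{\#\{x\in\Lambda_q : x\text{ is invertible}\}}{\#\Lambda_q}\ \ge\ e^{-d}.$$ In particular, for fixed $d$ this proportion is bounded below by a positive constant that does not depend on $n$, $q$, $K$, $L$, $\theta$ or $\gamma$. -/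

import Mathlib

open Module NumberField

/-- The cyclic algebra `(L/K, θ, γ) = L ⊕ u L ⊕ ⋯ ⊕ u^(d-1) L` with `d = [L : K]`, subject to
`a u = u θ(a)` for `a ∈ L` and `u^d = γ`.  An element is given by its `d` coordinates in `L`:
`x` stands for `∑ i, u^i (x.coeff i)`. -/
@[ext]
structure CyclicAlgebra {K L : Type*} [Field K] [Field L] [Algebra K L]
    (θ : L ≃ₐ[K] L) (γ : K) where
  coeff : Fin (finrank K L) → L

namespace CyclicAlgebra

noncomputable section

variable {K L : Type*} [Field K] [Field L] [Algebra K L] (θ : L ≃ₐ[K] L) (γ : K)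

instance : Add (CyclicAlgebra θ γ) := ⟨fun x y => ⟨x.coeff + y.coeff⟩⟩

instance : Zero (CyclicAlgebra θ γ) := ⟨⟨0⟩⟩

instance : Neg (CyclicAlgebra θ γ) := ⟨fun x => ⟨-x.coeff⟩⟩

instance : AddCommGroup (CyclicAlgebra θ γ) where
  add_assoc x y z := CyclicAlgebra.ext (add_assoc x.coeff y.coeff z.coeff)
  zero_add x := CyclicAlgebra.ext (zero_add x.coeff)
  add_zero x := CyclicAlgebra.ext (add_zero x.coeff)
  add_comm x y := CyclicAlgebra.ext (add_comm x.coeff y.coeff)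
  neg_add_cancel x := CyclicAlgebra.ext (neg_add_cancel x.coeff)
  nsmul := nsmulRec
  zsmul := zsmulRec

theorem coeff_add (x y : CyclicAlgebra θ γ) : (x + y).coeff = x.coeff + y.coeff := rfl

theorem coeff_zero : (0 : CyclicAlgebra θ γ).coeff = 0 := rfl

theorem coeff_neg (x : CyclicAlgebra θ γ) : (-x).coeff = -x.coeff := rfl

/-- The coordinates as an additive map. -/
def coeffHom : CyclicAlgebra θ γ →+ (Fin (finrank K L) → L) where
  toFun := coeff
  map_zero' := rfl
  map_add' _ _ := rfl

theorem coeff_sum {ι : Type*} (s : Finset ι) (f : ι → CyclicAlgebra θ γ) :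
    (∑ i ∈ s, f i).coeff = ∑ i ∈ s, (f i).coeff :=
  map_sum (coeffHom θ γ) f s

variable [FiniteDimensional K L]

/-- The element `u^m a` for an arbitrary exponent `m`: since `u^d = γ`, it is
`u^(m mod d) (γ^(m / d) a)`. -/
def mono (m : ℕ) (a : L) : CyclicAlgebra θ γ :=
  ⟨Pi.single ⟨m % finrank K L, Nat.mod_lt _ finrank_pos⟩
    (algebraMap K L γ ^ (m / finrank K L) * a)⟩

/-- `(u^j a) (u^k b) = u^(j+k) (θ^k(a) b)`, extended biadditively. -/
instance : Mul (CyclicAlgebra θ γ) where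
  mul x y := ∑ j : Fin (finrank K L), ∑ k : Fin (finrank K L),
    mono θ γ (j + k) ((θ ^ (k : ℕ)) (x.coeff j) * y.coeff k)

instance : One (CyclicAlgebra θ γ) where
  one := mono θ γ 0 1

theorem mul_def (x y : CyclicAlgebra θ γ) :
    x * y = ∑ j : Fin (finrank K L), ∑ k : Fin (finrank K L),
      mono θ γ (j + k) ((θ ^ (k : ℕ)) (x.coeff j) * y.coeff k) := rfl

theorem one_def : (1 : CyclicAlgebra θ γ) = mono θ γ 0 1 := rfl

theorem mono_add (m : ℕ) (a b : L) :
    mono θ γ m (a + b) = mono θ γ m a + mono θ γ m b := by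
  ext1
  simp only [mono, coeff_add, mul_add, Pi.single_add]

theorem mono_zero (m : ℕ) : mono θ γ m (0 : L) = 0 := by
  ext1
  simp only [mono, coeff_zero, mul_zero, Pi.single_zero]

theorem sum_mono (x : CyclicAlgebra θ γ) :
    ∑ j : Fin (finrank K L), mono θ γ (j : ℕ) (x.coeff j) = x := by
  ext1
  rw [coeff_sum]
  refine Eq.trans (Finset.sum_congr rfl fun j _ => ?_) (Finset.univ_sum_single x.coeff)
  have h1 : (⟨(j : ℕ) % finrank K L, Nat.mod_lt _ finrank_pos⟩ : Fin (finrank K L)) = j :=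
    Fin.ext (Nat.mod_eq_of_lt j.2)
  simp only [mono, h1, Nat.div_eq_of_lt j.2, pow_zero, one_mul]

instance : NonUnitalNonAssocRing (CyclicAlgebra θ γ) where
  left_distrib x y z := by
    simp only [mul_def, coeff_add, Pi.add_apply, mul_add, mono_add, Finset.sum_add_distrib]
  right_distrib x y z := by
    simp only [mul_def, coeff_add, Pi.add_apply, map_add, add_mul, mono_add,
      Finset.sum_add_distrib]
  zero_mul x := by simp [mul_def, coeff_zero, mono_zero]
  mul_zero x := by simp [mul_def, coeff_zero, mono_zero]

variable [IsGalois K L]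

theorem pow_mod_apply (n : ℕ) (a : L) : (θ ^ (n % finrank K L)) a = (θ ^ n) a := by
  have h : θ ^ finrank K L = 1 := by
    rw [← IsGalois.card_aut_eq_finrank]
    exact pow_card_eq_one'
  conv_rhs => rw [← Nat.mod_add_div n (finrank K L), pow_add, pow_mul, h, one_pow, mul_one]

theorem mono_mul_mono (m n : ℕ) (a b : L) :
    mono θ γ m a * mono θ γ n b = mono θ γ (m + n) ((θ ^ n) a * b) := by
  have hd : 0 < finrank K L := finrank_pos
  have key : ∀ (m : ℕ) (a : L) (i : Fin (finrank K L)), (i : ℕ) ≠ m % finrank K L →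
      (mono θ γ m a).coeff i = 0 := fun m a i hi =>
    Pi.single_eq_of_ne (fun h => hi (congrArg Fin.val h)) _
  have key' : ∀ (m : ℕ) (a : L), (mono θ γ m a).coeff ⟨m % finrank K L, Nat.mod_lt _ hd⟩
      = algebraMap K L γ ^ (m / finrank K L) * a := fun m a => Pi.single_eq_same _ _
  rw [mul_def, Finset.sum_eq_single ⟨m % finrank K L, Nat.mod_lt _ hd⟩,
    Finset.sum_eq_single ⟨n % finrank K L, Nat.mod_lt _ hd⟩, key', key']
  · simp only [map_mul, map_pow, AlgEquiv.commutes, pow_mod_apply]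
    have h1 : (m % finrank K L + n % finrank K L) % finrank K L = (m + n) % finrank K L := by
      simp
    have h2 : (m % finrank K L + n % finrank K L) / finrank K L + m / finrank K L
        + n / finrank K L = (m + n) / finrank K L := by
      have e : m + n = m % finrank K L + n % finrank K L
          + finrank K L * (m / finrank K L + n / finrank K L) := by
        have := Nat.mod_add_div m (finrank K L)
        have := Nat.mod_add_div n (finrank K L)
        rw [mul_add]
        omega
      conv_rhs => rw [e, Nat.add_mul_div_left _ _ hd]
      omega
    unfold mono
    congr 2
    · exact Fin.ext h1
    · rw [← h2, pow_add, pow_add]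
      ring
  · intro k _ hk
    rw [key n b k fun h => hk (Fin.ext h), mul_zero, mono_zero]
  · simp
  · intro j _ hj
    refine Finset.sum_eq_zero fun k _ => ?_
    rw [key m a j fun h => hj (Fin.ext h), map_zero, zero_mul, mono_zero]
  · simp

instance : Ring (CyclicAlgebra θ γ) where
  mul_assoc x y z := by
    rw [← sum_mono θ γ x, ← sum_mono θ γ y, ← sum_mono θ γ z]
    simp only [Finset.sum_mul, Finset.mul_sum, mono_mul_mono]
    refine Finset.sum_congr rfl fun i _ => Finset.sum_congr rfl fun j _ =>
      Finset.sum_congr rfl fun k _ => ?_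
    rw [map_mul, add_assoc, mul_assoc, add_comm (j : ℕ) (i : ℕ), pow_add, AlgEquiv.mul_apply]
  one_mul x := by
    conv_lhs => rw [← sum_mono θ γ x, one_def, Finset.mul_sum]
    conv_rhs => rw [← sum_mono θ γ x]
    simp only [mono_mul_mono, zero_add, map_one, one_mul]
  mul_one x := by
    conv_lhs => rw [← sum_mono θ γ x, one_def, Finset.sum_mul]
    conv_rhs => rw [← sum_mono θ γ x]
    simp only [mono_mul_mono, add_zero, pow_zero, AlgEquiv.one_apply, mul_one]

end

end CyclicAlgebra

noncomputable section

variable {K L : Type*} [Field K] [Field L] [Algebra K L] [FiniteDimensional K L]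

theorem CyclicAlgebra.isIntegral_mono (θ : L ≃ₐ[K] L) (γ : 𝓞 K) (m : ℕ) {a : L}
    (ha : IsIntegral ℤ a) (i : Fin (finrank K L)) :
    IsIntegral ℤ ((CyclicAlgebra.mono θ (γ : K) m a).coeff i) := by
  simp only [CyclicAlgebra.mono, Pi.single_apply]
  split_ifs
  · have h : IsIntegral ℤ (algebraMap K L (γ : K)) := γ.isIntegral_coe.algebraMap
    exact (h.pow _).mul ha
  · exact isIntegral_zero

variable [IsGalois K L]

/-- The natural order `Λ = 𝓞_L ⊕ u 𝓞_L ⊕ ⋯ ⊕ u^(d-1) 𝓞_L` of the cyclic algebra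
`(L/K, θ, γ)`, for `γ ∈ 𝓞_K`. -/
def naturalOrder (θ : L ≃ₐ[K] L) (γ : 𝓞 K) : Subring (CyclicAlgebra θ (γ : K)) where
  carrier := {x | ∀ i, IsIntegral ℤ (x.coeff i)}
  zero_mem' _ := isIntegral_zero
  one_mem' := CyclicAlgebra.isIntegral_mono θ γ 0 isIntegral_one
  add_mem' hx hy i := (hx i).add (hy i)
  neg_mem' hx i := (hx i).neg
  mul_mem' {x y} hx hy i := by
    rw [CyclicAlgebra.mul_def, CyclicAlgebra.coeff_sum, Finset.sum_apply]
    refine IsIntegral.sum _ fun j _ => ?_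
    rw [CyclicAlgebra.coeff_sum, Finset.sum_apply]
    refine IsIntegral.sum _ fun k _ => CyclicAlgebra.isIntegral_mono θ γ _ ?_ i
    exact ((hx j).map ((θ ^ (k : ℕ)).toAlgHom.restrictScalars ℤ)).mul (hy k)

/-- The ideal `⟨q⟩ = q Λ` of the natural order generated by an integer; it is two-sided. -/
def naturalOrderIdeal (θ : L ≃ₐ[K] L) (γ : 𝓞 K) (q : ℕ) : Ideal (naturalOrder θ γ) :=
  Ideal.span {(q : naturalOrder θ γ)}

instance (θ : L ≃ₐ[K] L) (γ : 𝓞 K) (q : ℕ) : (naturalOrderIdeal θ γ q).IsTwoSided where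
  mul_mem_of_left {a} b ha := by
    obtain ⟨c, rfl⟩ := Ideal.mem_span_singleton'.1 ha
    refine Ideal.mem_span_singleton'.2 ⟨c * b, ?_⟩
    rw [mul_assoc, mul_assoc, (Nat.cast_commute q b).eq]

/-- The quotient ring `Λ_q = Λ / q Λ`. -/
abbrev NaturalOrderQuotient (θ : L ≃ₐ[K] L) (γ : 𝓞 K) (q : ℕ) : Type _ :=
  naturalOrder θ γ ⧸ naturalOrderIdeal θ γ q

end

/-- `q` splits completely in the number field `K` of degree `n`: the ideal `q 𝓞_K` is a product
of `n` distinct prime ideals. -/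
def SplitsCompletely (K : Type*) [Field K] [NumberField K] (q : ℕ) : Prop :=
  ∃ 𝔮 : Fin (finrank ℚ K) → Ideal (𝓞 K), Function.Injective 𝔮 ∧ (∀ i, (𝔮 i).IsPrime) ∧
    Ideal.span {(q : 𝓞 K)} = ∏ i, 𝔮 i

/-! Units are counted through idempotents (`pow_mul_card_le_card_isUnit`). In a finite ring with `q
= 0`, units are detected modulo the Jacobson radical. The semisimple quotient is a product of matrix
rings `M_{d_i}(F_i)` over finite fields with at least `q` elements, and each has unit proportion at
least `(1 - 1/q)^{d_i}`. Diagonal matrix units lift to orthogonal idempotents, so `∑ d_i` is at most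
the idempotent width.

The width of `Λ_q` is at most `n d`. By `exists_reduction`, each `𝔮` gives a map to a ring of width
at most `d`: matrices over `𝓞_L / P` with `P` above `𝔮` if `γ ∉ 𝔮`, the constant coordinate in `𝓞_L
/ 𝔮 𝓞_L` if `γ ∈ 𝔮`. Elements killed by all these maps are nilpotent modulo `∏ 𝔮_k = (q)`, so every
nonzero idempotent survives in some target (`IdempotentWidthLE.of_ringHom`). Finally `(1 - 1/q)^{nd}
≥ e^{-d}` because `n ≤ q - 1`. -/

/-! ### Units and idempotents in finite rings. -/

theorem isNilpotent_of_mem_jacobson {R : Type*} [Ring R] [IsSemiprimaryRing R] {x : R}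
    (hx : x ∈ Ring.jacobson R) : IsNilpotent x := by
  obtain ⟨n, hn⟩ := IsSemiprimaryRing.isNilpotent (R := R)
  exact ⟨n, by simpa [hn] using Ideal.pow_mem_pow hx n⟩

/-- A product that is `1` modulo the radical is `1` minus a nilpotent, hence a unit; applied to `x *
y` and `y * x`, this gives `x` a right and a left inverse. -/
theorem isUnit_mk_jacobson_iff {R : Type*} [Ring R] [IsSemiprimaryRing R] {x : R} :
    IsUnit (Ideal.Quotient.mk (Ring.jacobson R) x) ↔ IsUnit x := by
  refine ⟨fun h => ?_, fun h => h.map _⟩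
  have key : ∀ a b : R, Ideal.Quotient.mk (Ring.jacobson R) (a * b) = 1 → IsUnit (a * b) := by
    intro a b hab
    rw [← map_one (Ideal.Quotient.mk (Ring.jacobson R)), eq_comm, Ideal.Quotient.eq] at hab
    simpa using (isNilpotent_of_mem_jacobson hab).isUnit_one_sub
  obtain ⟨y, hxy, hyx⟩ := isUnit_iff_exists.1 h
  obtain ⟨y, rfl⟩ := Ideal.Quotient.mk_surjective y
  rw [← map_mul] at hxy hyx
  obtain ⟨u, hu⟩ := key _ _ hxy
  obtain ⟨v, hv⟩ := key _ _ hyx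
  refine isUnit_iff_exists_and_exists.2 ⟨⟨y * ↑u⁻¹, ?_⟩, ⟨↑v⁻¹ * y, ?_⟩⟩
  · rw [← mul_assoc, ← hu, Units.mul_inv]
  · rw [mul_assoc, ← hv, Units.inv_mul]

theorem card_isUnit_eq_card_jacobson_mul (R : Type*) [Ring R] [IsSemiprimaryRing R] :
    Nat.card {x : R // IsUnit x} =
      Nat.card (Ring.jacobson R) * Nat.card {x : R ⧸ Ring.jacobson R // IsUnit x} := by
  rw [← Nat.card_prod]
  refine Nat.card_congr (Equiv.trans (Equiv.subtypeEquivRight fun x => ?_)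
    (QuotientAddGroup.preimageMkEquivAddSubgroupProdSet (Ring.jacobson R).toAddSubgroup
      {x : R ⧸ Ring.jacobson R | IsUnit x}))
  exact isUnit_mk_jacobson_iff.symm

/-- A finite nontrivial ring in which the prime `q` vanishes has at least `q` elements. -/
theorem le_natCard_of_natCast_eq_zero {D : Type*} [Ring D] [Nontrivial D] [Finite D] {q : ℕ}
    (hq : q.Prime) (h : (q : D) = 0) : q ≤ Nat.card D := by
  have h1 : addOrderOf (1 : D) = q := by
    refine ((Nat.dvd_prime hq).1 (addOrderOf_dvd_of_nsmul_eq_zero (by simpa using h))).resolve_left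
      fun h1 => one_ne_zero (α := D) (AddMonoid.addOrderOf_eq_one_iff.1 h1)
  rw [← h1]
  exact addOrderOf_le_card

/-- With `Q = #F`, the order of `GL_n` is `∏ (Q^n - Q^i)` over `i < n`, and each factor is at least
`Q^n - Q^(n-1) ≥ (1 - 1/q) Q^n`. -/
theorem pow_mul_card_matrix_le {F : Type*} [Field F] [Finite F] {q : ℕ} (hq : 1 < q)
    (hF : q ≤ Nat.card F) (n : ℕ) :
    (1 - 1 / (q : ℝ)) ^ n * Nat.card (Matrix (Fin n) (Fin n) F) ≤
      Nat.card (Matrix (Fin n) (Fin n) F)ˣ := by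
  have : Fintype F := Fintype.ofFinite F
  have h := Matrix.card_GL_field (𝔽 := F) n
  rw [Matrix.GeneralLinearGroup] at h
  rw [h]
  rw [Nat.card_eq_fintype_card] at hF
  have hc : Nat.card (Matrix (Fin n) (Fin n) F) = (Fintype.card F ^ n) ^ n := by
    rw [Matrix, Nat.card_fun, Nat.card_fun]; simp
  rw [hc]
  set Q := Fintype.card F
  have hq0 : (1 : ℝ) < q := by exact_mod_cast hq
  have hQ : (q : ℝ) ≤ Q := by exact_mod_cast hF
  push_cast
  rw [← mul_pow]
  calc ((1 - 1 / (q : ℝ)) * (Q : ℝ) ^ n) ^ n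
      = ∏ i : Fin n, ((1 - 1 / (q : ℝ)) * (Q : ℝ) ^ n) := by simp
    _ ≤ _ := by
      refine Finset.prod_le_prod (fun i _ => ?_) (fun i _ => ?_)
      · have : 1 / (q : ℝ) ≤ 1 := by rw [div_le_one (by linarith)]; exact hq0.le
        exact mul_nonneg (by linarith) (by positivity)
      · have hle : Q ^ (i : ℕ) ≤ Q ^ n := Nat.pow_le_pow_right (by omega) i.2.le
        rw [Nat.cast_sub hle]
        push_cast
        have h2 : (Q : ℝ) ^ (i : ℕ) * q ≤ (Q : ℝ) ^ n := by
          calc (Q : ℝ) ^ (i : ℕ) * q ≤ (Q : ℝ) ^ (i : ℕ) * Q := by gcongr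
            _ = (Q : ℝ) ^ ((i : ℕ) + 1) := (pow_succ _ _).symm
            _ ≤ (Q : ℝ) ^ n := pow_le_pow_right₀ (by linarith) i.2
        have h3 : (Q : ℝ) ^ (i : ℕ) ≤ (Q : ℝ) ^ n / q := by
          rw [le_div_iff₀ (by linarith)]; exact h2
        have : (1 - 1 / (q : ℝ)) * (Q : ℝ) ^ n = (Q : ℝ) ^ n - (Q : ℝ) ^ n / q := by ring
        linarith

theorem orthogonalIdempotents_pi_sigma {ι : Type*} [DecidableEq ι] {κ : ι → Type*}
    {R : ι → Type*} [∀ i, Ring (R i)]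
    {e : ∀ i, κ i → R i} (he : ∀ i, OrthogonalIdempotents (e i)) :
    OrthogonalIdempotents (fun a : Σ i, κ i => (Pi.single a.1 (e a.1 a.2) : ∀ i, R i)) := by
  refine ⟨fun a => ?_, fun a b hab => ?_⟩
  · rw [IsIdempotentElem, ← Pi.single_mul, ((he a.1).idem a.2).eq]
  · obtain ⟨i, a⟩ := a
    obtain ⟨j, b⟩ := b
    by_cases hij : i = j
    · subst hij
      have hne : a ≠ b := fun h => hab (by rw [h])
      change Pi.single i (e i a) * Pi.single i (e i b) = 0
      rw [← Pi.single_mul, (he i).ortho hne, Pi.single_zero]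
    · ext k
      by_cases hk : k = i
      · subst hk; simp [hij]
      · simp [hk]

theorem orthogonalIdempotents_matrix_single {m : Type*} [Fintype m] [DecidableEq m]
    (D : Type*) [Ring D] :
    OrthogonalIdempotents (fun i : m => (Matrix.single i i 1 : Matrix m m D)) := by
  refine ⟨fun i => by simp [IsIdempotentElem], fun i j h => ?_⟩
  simp [Matrix.single_mul_single_of_ne _ _ _ _ h]

/-- Orthogonal families of nonzero idempotents of `R` have at most `d` members. -/
def IdempotentWidthLE (R : Type*) [Ring R] (d : ℕ) : Prop :=
  ∀ (ι : Type) [Fintype ι] (e : ι → R), OrthogonalIdempotents e → (∀ i, e i ≠ 0) →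
    Fintype.card ι ≤ d

/-- A finite ring killed by a prime `q`, in which orthogonal families of nonzero idempotents have
at most `B` members, has a proportion of units of at least `(1 - 1 / q) ^ B`. -/
theorem pow_mul_card_le_card_isUnit {R : Type*} [Ring R] [Finite R] {q : ℕ} (hq : q.Prime)
    (h0 : (q : R) = 0) {B : ℕ}
    (hB : IdempotentWidthLE R B) :
    (1 - 1 / (q : ℝ)) ^ B * Nat.card R ≤ Nat.card {x : R // IsUnit x} := by
  classical
  obtain ⟨n, D, d, _, hd, ⟨f⟩⟩ :=
    IsSemisimpleRing.exists_ringEquiv_pi_matrix_divisionRing (R ⧸ Ring.jacobson R)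
  have hquot : Finite (R ⧸ Ring.jacobson R) :=
    Finite.of_surjective _ Ideal.Quotient.mk_surjective
  have hfin : Finite (∀ i, Matrix (Fin (d i)) (Fin (d i)) (D i)) := Finite.of_equiv _ f.toEquiv
  have hq1 : (1 : ℝ) < q := by exact_mod_cast hq.one_lt
  have hp0 : 0 ≤ 1 - 1 / (q : ℝ) := by
    have : 1 / (q : ℝ) ≤ 1 := by rw [div_le_one (by linarith)]; exact hq1.le
    linarith
  have hp1 : 1 - 1 / (q : ℝ) ≤ 1 := by
    have : 0 ≤ 1 / (q : ℝ) := by positivity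
    linarith
  have hMfin : ∀ i, Finite (Matrix (Fin (d i)) (Fin (d i)) (D i)) := fun i =>
    Finite.of_surjective (fun x : ∀ i, Matrix (Fin (d i)) (Fin (d i)) (D i) => x i)
      (Function.surjective_eval i)
  have hDfin : ∀ i, Finite (D i) := fun i =>
    Finite.of_surjective (fun x : Matrix (Fin (d i)) (Fin (d i)) (D i) => x 0 0)
      fun a => ⟨fun _ _ => a, rfl⟩
  have hq0 : (q : ∀ i, Matrix (Fin (d i)) (Fin (d i)) (D i)) = 0 := by
    have := congrArg (fun x => f (Ideal.Quotient.mk (Ring.jacobson R) x)) h0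
    simpa using this
  have hqD : ∀ i, (q : D i) = 0 := fun i => by
    have := congrFun (congrFun (congrFun hq0 i) 0) 0
    simpa [Matrix.natCast_apply] using this
  -- The diagonal matrix units of all blocks form an orthogonal family of size `∑ d i`; it lifts to
  -- `R` because the radical is nil.
  have hsum : ∑ i, d i ≤ B := by
    have hE := orthogonalIdempotents_pi_sigma fun i =>
      orthogonalIdempotents_matrix_single (m := Fin (d i)) (D i)
    have hE' := hE.map (f.symm : _ →+* R ⧸ Ring.jacobson R)
    obtain ⟨e, he, hfe⟩ := OrthogonalIdempotents.lift_of_isNilpotent_ker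
      (Ideal.Quotient.mk (Ring.jacobson R))
      (fun x hx => isNilpotent_of_mem_jacobson (by rwa [Ideal.mk_ker] at hx)) hE'
      (fun i => Ideal.Quotient.mk_surjective _)
    have := hB _ e he fun a ha => ?_
    · simpa using this
    · have h1 := congrFun hfe a
      rw [Function.comp_apply, ha, map_zero, Function.comp_apply, eq_comm] at h1
      have h2 : (Pi.single a.1 (Matrix.single a.2 a.2 1) :
        ∀ i, Matrix (Fin (d i)) (Fin (d i)) (D i)) = 0 := by simpa using h1
      have h3 := congrFun (congrFun (congrFun h2 a.1) a.2) a.2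
      simp at h3
  have hS : Nat.card (R ⧸ Ring.jacobson R) =
      ∏ i, Nat.card (Matrix (Fin (d i)) (Fin (d i)) (D i)) := by
    rw [Nat.card_congr f.toEquiv, Nat.card_pi]
  have hU : Nat.card {x : R ⧸ Ring.jacobson R // IsUnit x} =
      ∏ i, Nat.card (Matrix (Fin (d i)) (Fin (d i)) (D i))ˣ := by
    rw [← Nat.card_pi, ← Nat.card_congr MulEquiv.piUnits.toEquiv,
      ← Nat.card_congr (Units.mapEquiv f.toMulEquiv).toEquiv]
    exact Nat.card_congr Submonoid.unitsTypeEquivIsUnitSubmonoid.symm.toEquiv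
  rw [card_isUnit_eq_card_jacobson_mul, Submodule.card_eq_card_quotient_mul_card (Ring.jacobson R),
    hS, hU]
  push_cast
  have hmain : (1 - 1 / (q : ℝ)) ^ B * ∏ i, (Nat.card (Matrix (Fin (d i)) (Fin (d i)) (D i)) : ℝ)
      ≤ ∏ i, (Nat.card (Matrix (Fin (d i)) (Fin (d i)) (D i))ˣ : ℝ) := by
    calc _ ≤ (1 - 1 / (q : ℝ)) ^ (∑ i, d i) *
          ∏ i, (Nat.card (Matrix (Fin (d i)) (Fin (d i)) (D i)) : ℝ) := by
          exact mul_le_mul_of_nonneg_right (pow_le_pow_of_le_one hp0 hp1 hsum) (by positivity)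
      _ = ∏ i, (1 - 1 / (q : ℝ)) ^ d i * (Nat.card (Matrix (Fin (d i)) (Fin (d i)) (D i)) : ℝ) := by
          rw [Finset.prod_mul_distrib, Finset.prod_pow_eq_pow_sum]
      _ ≤ _ := Finset.prod_le_prod (fun i _ => by positivity) fun i _ =>
          -- Wedderburn's little theorem makes the finite division ring `D i` a field.
          pow_mul_card_matrix_le hq.one_lt (le_natCard_of_natCast_eq_zero hq (hqD i)) (d i)
  calc _ = (Nat.card (Ring.jacobson R) : ℝ) * ((1 - 1 / (q : ℝ)) ^ B *
        ∏ i, (Nat.card (Matrix (Fin (d i)) (Fin (d i)) (D i)) : ℝ)) := by ring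
    _ ≤ _ := by gcongr

/-- Nonzero vectors chosen in the images of orthogonal idempotents are linearly independent. -/
theorem idempotentWidthLE_end (F M : Type*) [Field F] [AddCommGroup M]
    [Module F M] [Module.Finite F M] : IdempotentWidthLE (Module.End F M) (finrank F M) := by
  intro ι _ e he h0
  have hv : ∀ i, ∃ v, e i v ≠ 0 := fun i => by
    by_contra! h
    exact h0 i (LinearMap.ext h)
  choose v hv using hv
  refine LinearIndependent.fintype_card_le_finrank (b := fun i => e i (v i)) (R := F) ?_
  rw [Fintype.linearIndependent_iff]
  intro g hg i
  have h := congrArg (e i) hg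
  rw [map_sum, Finset.sum_eq_single i, map_smul, ← Module.End.mul_apply, (he.idem i).eq,
    map_zero] at h
  · exact (smul_eq_zero.1 h).resolve_right (hv i)
  · intro j _ hj
    rw [map_smul, ← Module.End.mul_apply, he.ortho hj.symm, LinearMap.zero_apply, smul_zero]
  · simp

/-- A ring which maps to finitely many rings of idempotent width at most `d`, with only nilpotent
elements in the common kernel, has idempotent width at most `d` times the number of maps. -/
theorem IdempotentWidthLE.of_ringHom {R κ : Type*} [Ring R] [Fintype κ] {d : ℕ}
    {S : κ → Type*} [∀ k, Ring (S k)] (hS : ∀ k, IdempotentWidthLE (S k) d)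
    (φ : ∀ k, R →+* S k) (hφ : ∀ x, (∀ k, φ k x = 0) → IsNilpotent x) :
    IdempotentWidthLE R (Fintype.card κ * d) := by
  classical
  intro ι _ e he h0
  have h1 : ∀ i, ∃ k, φ k (e i) ≠ 0 := fun i => by
    by_contra! h
    obtain ⟨N, hN⟩ := hφ _ h
    rcases N with _ | N
    · rw [pow_zero] at hN
      exact h0 i (by rw [← mul_one (e i), hN, mul_zero])
    · exact h0 i (by rwa [(he.idem i).pow_succ_eq] at hN)
  -- Each idempotent is assigned to a map that does not kill it; every fibre of this assignment
  -- stays an orthogonal nonzero family in its target.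
  choose k hk using h1
  calc Fintype.card ι = ∑ j, (Finset.univ.filter fun i => k i = j).card := by
        rw [← Finset.card_univ]
        exact Finset.card_eq_sum_card_fiberwise fun _ _ => Finset.mem_coe.2 (Finset.mem_univ _)
    _ ≤ ∑ j : κ, d := Finset.sum_le_sum fun j _ => ?_
    _ = _ := by simp
  have h2 := hS j _ _
    ((he.embedding (Function.Embedding.subtype fun i => k i = j)).map (φ j))
    (by rintro ⟨i, rfl⟩; exact hk i)
  rwa [Fintype.card_subtype] at h2

theorem IdempotentWidthLE.of_injective {R S : Type*} [Ring R] [Ring S] {d : ℕ}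
    (hS : IdempotentWidthLE S d) (f : R →+* S) (hf : Function.Injective f) :
    IdempotentWidthLE R d := fun ι _ _ he h0 =>
  hS ι _ (he.map f) fun i => (map_ne_zero_iff f hf).2 (h0 i)

/-- From `log t ≥ 1 - 1/t` one gets `log (1 - 1/q) ≥ -1/(q - 1) `, and `n ≤ q - 1`. -/
theorem exp_neg_le_pow {q : ℕ} (hq : 2 ≤ q) {n d : ℕ} (hn : n + 1 ≤ q) :
    Real.exp (-(d : ℝ)) ≤ (1 - 1 / (q : ℝ)) ^ (n * d) := by
  have hq2 : (2 : ℝ) ≤ q := by exact_mod_cast hq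
  have hn' : (n : ℝ) ≤ q - 1 := by
    have : ((n + 1 : ℕ) : ℝ) ≤ q := by exact_mod_cast hn
    push_cast at this; linarith
  have hpos : 0 < 1 - 1 / (q : ℝ) := by
    rw [sub_pos, div_lt_one (by linarith)]; linarith
  have hlog := Real.one_sub_inv_le_log_of_pos hpos
  have hinv : 1 - (1 - 1 / (q : ℝ))⁻¹ = -(1 / ((q : ℝ) - 1)) := by
    have : (q : ℝ) - 1 ≠ 0 := by linarith
    field_simp
    ring
  rw [hinv] at hlog
  rw [← Real.log_le_log_iff (Real.exp_pos _) (by positivity), Real.log_exp, Real.log_pow]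
  have h1 : -1 ≤ (n : ℝ) * Real.log (1 - 1 / (q : ℝ)) := by
    have h2 : (n : ℝ) * -(1 / ((q : ℝ) - 1)) ≤ (n : ℝ) * Real.log (1 - 1 / (q : ℝ)) := by gcongr
    have h3 : (n : ℝ) * (1 / ((q : ℝ) - 1)) ≤ 1 := by
      rw [mul_one_div, div_le_one (by linarith)]; exact hn'
    linarith
  push_cast
  nlinarith [(Nat.cast_nonneg d : (0 : ℝ) ≤ d)]

/-! ### Powers of matrices modulo ideals. -/

theorem Matrix.pow_apply_mem_pow {n C : Type*} [Fintype n] [DecidableEq n] [CommRing C]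
    {I : Ideal C} {A : Matrix n n C} (hA : ∀ i j, A i j ∈ I) (N : ℕ) :
    ∀ i j, (A ^ N) i j ∈ I ^ N := by
  induction N with
  | zero => simp
  | succ N ih =>
    intro i j
    rw [pow_succ, pow_succ, Matrix.mul_apply]
    exact Ideal.sum_mem _ fun k _ => Ideal.mul_mem_mul (ih i k) (hA k j)

theorem Matrix.pow_sum_apply_mem_prod {n C κ : Type*} [Fintype n] [DecidableEq n] [CommRing C]
    {I : κ → Ideal C} {A : Matrix n n C} {N : κ → ℕ} (s : Finset κ)
    (hA : ∀ k ∈ s, ∀ i j, (A ^ N k) i j ∈ I k) :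
    ∀ i j, (A ^ ∑ k ∈ s, N k) i j ∈ ∏ k ∈ s, I k := by
  classical
  induction s using Finset.induction_on with
  | empty => simp
  | insert a s ha ih =>
    intro i j
    rw [Finset.sum_insert ha, Finset.prod_insert ha, pow_add, Matrix.mul_apply]
    exact Ideal.sum_mem _ fun k _ => Ideal.mul_mem_mul (hA a (Finset.mem_insert_self a s) i k)
      (ih (fun b hb => hA b (Finset.mem_insert_of_mem hb)) k j)

/-- Cayley–Hamilton: the transpose is upper triangular with zero diagonal, so its characteristic
polynomial is `X^m`. -/
theorem Matrix.pow_card_eq_zero_of_strictly_lower {m : ℕ} {C : Type*} [CommRing C]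
    {A : Matrix (Fin m) (Fin m) C} (hA : ∀ i j, i ≤ j → A i j = 0) : A ^ m = 0 := by
  have h : A.transpose.IsUpperTriangular := fun i j hij => hA j i (le_of_lt hij)
  have h1 := A.transpose.charpoly_of_isUpperTriangular h
  have h2 := A.transpose.aeval_self_charpoly
  rw [h1] at h2
  have h3 : ∀ i, A.transpose i i = 0 := fun i => hA i i le_rfl
  simp only [h3, map_zero, sub_zero, Finset.prod_const, Finset.card_univ, Fintype.card_fin,
    map_pow, Polynomial.aeval_X] at h2
  rw [← Matrix.transpose_pow] at h2
  exact Matrix.transpose_injective h2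

/-! ### Left multiplication in coordinates. -/

namespace CyclicAlgebra

variable {K L : Type*} [Field K] [Field L] [Algebra K L] [FiniteDimensional K L]
  (θ : L ≃ₐ[K] L)

theorem mono_coeff (γ : K) (m : ℕ) (a : L) (i : Fin (finrank K L)) :
    (mono θ γ m a).coeff i =
      if (i : ℕ) = m % finrank K L then algebraMap K L γ ^ (m / finrank K L) * a else 0 := by
  simp only [mono, Pi.single_apply, Fin.ext_iff]

variable [IsGalois K L]

theorem mul_mono_coeff (γ : K) (x : CyclicAlgebra θ γ) (j : ℕ) (a : L) (i : Fin (finrank K L)) :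
    (x * mono θ γ j a).coeff i =
      ∑ k : Fin (finrank K L), (mono θ γ (k + j) ((θ ^ j) (x.coeff k) * a)).coeff i := by
  conv_lhs => rw [← sum_mono θ γ x, Finset.sum_mul]
  simp only [mono_mul_mono, coeff_sum, Finset.sum_apply]

/-- Scalars stand to the right of the powers of `u`, so left multiplication is right `L`-linear and
has a matrix over `L`. -/
theorem mul_mono_coeff_eq_mul (γ : K) (x : CyclicAlgebra θ γ) (j : ℕ) (a : L)
    (i : Fin (finrank K L)) :
    (x * mono θ γ j a).coeff i = (x * mono θ γ j 1).coeff i * a := by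
  rw [mul_mono_coeff, mul_mono_coeff, Finset.sum_mul]
  refine Finset.sum_congr rfl fun k _ => ?_
  rw [mono_coeff, mono_coeff]
  split_ifs
  · ring
  · rw [zero_mul]

theorem mul_coeff (γ : K) (x y : CyclicAlgebra θ γ) (i : Fin (finrank K L)) :
    (x * y).coeff i = ∑ k : Fin (finrank K L), (x * mono θ γ k 1).coeff i * y.coeff k := by
  conv_lhs => rw [← sum_mono θ γ y, Finset.mul_sum, coeff_sum, Finset.sum_apply]
  exact Finset.sum_congr rfl fun k _ => mul_mono_coeff_eq_mul θ γ x k _ i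

theorem mul_mono_one_coeff (γ : K) (x : CyclicAlgebra θ γ) (i j k : Fin (finrank K L))
    (h : (i : ℕ) = (k + j) % finrank K L) :
    (x * mono θ γ j 1).coeff i =
      algebraMap K L γ ^ ((k + j : ℕ) / finrank K L) * (θ ^ (j : ℕ)) (x.coeff k) := by
  rw [mul_mono_coeff, Finset.sum_eq_single k]
  · rw [mono_coeff, if_pos h, mul_one]
  · intro l _ hl
    rw [mono_coeff, if_neg]
    intro h'
    have h1 : (k + j : ℕ) ≡ l + j [MOD finrank K L] := h.symm.trans h'
    have h2 := Nat.ModEq.add_right_cancel' _ h1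
    exact hl (Fin.ext (h2.eq_of_lt_of_lt k.2 l.2).symm)
  · simp

end CyclicAlgebra

/-! ### The left regular representation over `𝓞_L`. -/

section NaturalOrder

open CyclicAlgebra

variable {K L : Type*} [Field K] [Field L] [Algebra K L] [FiniteDimensional K L]
  [IsGalois K L] (θ : L ≃ₐ[K] L) (γ : 𝓞 K)

/-- Left multiplication on the natural order, as a matrix over `𝓞 L` in the right basis
`1, u, …, u ^ (d - 1)`. -/
noncomputable def naturalOrderMatrix :
    naturalOrder θ γ →+* Matrix (Fin (finrank K L)) (Fin (finrank K L)) (𝓞 L) where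
  toFun x := Matrix.of fun i j => ⟨((x : CyclicAlgebra θ (γ : K)) * mono θ (γ : K) j 1).coeff i,
    ((naturalOrder θ γ).mul_mem x.2 
      (show mono θ (γ : K) j 1 ∈ naturalOrder θ γ from isIntegral_mono θ γ j isIntegral_one)) i⟩
  map_one' := by
    refine Matrix.ext fun i j => RingOfIntegers.coe_injective ?_
    change ((1 : CyclicAlgebra θ (γ : K)) * mono θ (γ : K) j 1).coeff i = _
    rw [one_mul, mono_coeff, Nat.mod_eq_of_lt j.2, Nat.div_eq_of_lt j.2, Matrix.one_apply]
    by_cases h : i = j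
    · rw [if_pos (congrArg Fin.val h), if_pos h, map_one, pow_zero, one_mul]
    · rw [if_neg (fun h' => h (Fin.ext h')), if_neg h, map_zero]
  map_mul' x y := by
    refine Matrix.ext fun i j => RingOfIntegers.coe_injective ?_
    rw [Matrix.mul_apply, map_sum]
    change ((x : CyclicAlgebra θ (γ : K)) * y * mono θ (γ : K) j 1).coeff i = _
    rw [mul_assoc, mul_coeff]
    rfl
  map_zero' := by
    refine Matrix.ext fun i j => RingOfIntegers.coe_injective ?_
    change ((0 : CyclicAlgebra θ (γ : K)) * mono θ (γ : K) j 1).coeff i = _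
    rw [zero_mul]
    rfl
  map_add' x y := by
    refine Matrix.ext fun i j => RingOfIntegers.coe_injective ?_
    change (((x : CyclicAlgebra θ (γ : K)) + y) * mono θ (γ : K) j 1).coeff i = _
    rw [add_mul]
    rfl

/-- The coordinates of an element of the natural order. -/
def naturalOrderCoeff (x : naturalOrder θ γ) (k : Fin (finrank K L)) : 𝓞 L :=
  ⟨(x : CyclicAlgebra θ (γ : K)).coeff k, x.2 k⟩

theorem naturalOrderMatrix_apply [NumberField K] [NumberField L] (x : naturalOrder θ γ)
    (i j k : Fin (finrank K L)) (h : (i : ℕ) = (k + j) % finrank K L) :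
    naturalOrderMatrix θ γ x i j = algebraMap (𝓞 K) (𝓞 L) γ ^ ((k + j : ℕ) / finrank K L) *
      (θ ^ (j : ℕ)) • naturalOrderCoeff θ γ x k := by
  refine RingOfIntegers.coe_injective ?_
  rw [map_mul, map_pow]
  exact mul_mono_one_coeff θ (γ : K) x i j k h

/-- Column `0` of the matrix is the coordinate vector of `x`, so it can be divided by `q`
coordinatewise. -/
theorem mem_naturalOrderIdeal {q : ℕ} {x : naturalOrder θ γ}
    (hx : ∀ i j, naturalOrderMatrix θ γ x i j ∈ Ideal.span {(q : 𝓞 L)}) :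
    x ∈ naturalOrderIdeal θ γ q := by
  have h : ∀ i, ∃ c : 𝓞 L, c * q = naturalOrderCoeff θ γ x i := fun i => by
    have := hx i ⟨0, finrank_pos⟩
    rw [Ideal.mem_span_singleton'] at this
    obtain ⟨c, hc⟩ := this
    refine ⟨c, hc.trans ?_⟩
    refine RingOfIntegers.coe_injective ?_
    change ((x : CyclicAlgebra θ (γ : K)) * mono θ (γ : K) 0 1).coeff i = _
    rw [← one_def, mul_one]
    rfl
  choose c hc using h
  refine Ideal.mem_span_singleton'.2 ⟨⟨⟨fun i => c i⟩, fun i => (c i).2⟩, ?_⟩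
  rw [← nsmul_eq_mul']
  ext i
  have h1 := congrArg (fun y : 𝓞 L => (y : L)) (hc i)
  simp only [map_mul, map_natCast] at h1
  refine Eq.trans ?_ h1
  change coeffHom θ (γ : K) (q • (⟨fun i => (c i : L)⟩ : CyclicAlgebra θ (γ : K))) i = _
  rw [map_nsmul, Pi.smul_apply, nsmul_eq_mul, mul_comm]
  rfl

theorem finite_naturalOrderQuotient [NumberField L] {q : ℕ} (hq : q ≠ 0) :
    Finite (NaturalOrderQuotient θ γ q) := by
  have hfin : Finite (𝓞 L ⧸ Ideal.span {(q : 𝓞 L)}) :=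
    Ideal.finiteQuotientOfFreeOfNeBot _ (by simpa using hq)
  let φ := (Ideal.Quotient.mk (Ideal.span {(q : 𝓞 L)})).mapMatrix.comp (naturalOrderMatrix θ γ)
  have h1 : Finite (naturalOrder θ γ ⧸ RingHom.ker φ) :=
    have : Finite (Matrix (Fin (finrank K L)) (Fin (finrank K L))
      (𝓞 L ⧸ Ideal.span {(q : 𝓞 L)})) := inferInstanceAs (Finite (_ → _ → _))
    Finite.of_injective _ (RingHom.kerLift_injective φ)
  have h2 : RingHom.ker φ ≤ naturalOrderIdeal θ γ q := fun x hx =>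
    mem_naturalOrderIdeal θ γ fun i j => by
      have := congrArg (fun A : Matrix _ _ (𝓞 L ⧸ Ideal.span {(q : 𝓞 L)}) => A i j)
        (RingHom.mem_ker.1 hx)
      exact Ideal.Quotient.eq_zero_iff_mem.1 this
  exact Finite.of_surjective _ (Ideal.Quotient.factor_surjective h2)

end NaturalOrder

/-! ### Galois action on the primes above `𝔮`. -/

section Galois

variable {K L : Type*} [Field K] [NumberField K] [Field L] [NumberField L] [Algebra K L]
  [IsGalois K L]

theorem smul_mem_map_of_mem (𝔮 : Ideal (𝓞 K)) (σ : L ≃ₐ[K] L) {y : 𝓞 L}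
    (hy : y ∈ 𝔮.map (algebraMap (𝓞 K) (𝓞 L))) : σ • y ∈ 𝔮.map (algebraMap (𝓞 K) (𝓞 L)) := by
  have h : 𝔮.map (algebraMap (𝓞 K) (𝓞 L)) ≤
      (𝔮.map (algebraMap (𝓞 K) (𝓞 L))).comap (MulSemiringAction.toRingHom Gal(L/K) (𝓞 L) σ) := by
    rw [Ideal.map_le_iff_le_comap]
    intro a ha
    rw [Ideal.mem_comap, Ideal.mem_comap, MulSemiringAction.toRingHom_apply, smul_algebraMap]
    exact Ideal.mem_map_of_mem _ ha
  exact h hy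

/-- An integer whose conjugates all lie in one prime above `𝔮` lies in the radical of `𝔮 𝓞_L`. -/
theorem mem_radical_map_of_forall_smul_mem {𝔮 : Ideal (𝓞 K)} [𝔮.IsMaximal] {P : Ideal (𝓞 L)}
    [P.IsPrime] (hP : P.under (𝓞 K) = 𝔮) {y : 𝓞 L} (hy : ∀ σ : L ≃ₐ[K] L, σ • y ∈ P) :
    y ∈ (𝔮.map (algebraMap (𝓞 K) (𝓞 L))).radical := by
  rw [Ideal.radical_eq_sInf, Ideal.mem_sInf]
  rintro Q ⟨hQ, hQp⟩
  have hQu : Q.under (𝓞 K) = 𝔮 :=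
    (Ideal.IsMaximal.eq_of_le ‹_› (hQp.under (𝓞 K)).ne_top (Ideal.map_le_iff_le_comap.1 hQ)).symm
  -- The Galois group is transitive on the primes above `𝔮`.
  obtain ⟨σ, rfl⟩ := Algebra.IsInvariant.exists_smul_of_under_eq (𝓞 K) (𝓞 L) Gal(L/K) P Q
    (hP.trans hQu.symm)
  rw [Ideal.mem_pointwise_smul_iff_inv_smul_mem]
  exact hy σ⁻¹

end Galois

/-! ### Reduction of the natural order at one prime of `K`. -/

section Reduction

variable {K L : Type*} [Field K] [NumberField K] [Field L] [NumberField L] [Algebra K L]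
  [FiniteDimensional K L] [IsGalois K L] (θ : L ≃ₐ[K] L) (γ : 𝓞 K)

theorem naturalOrderMatrix_apply_add (x : naturalOrder θ γ) (j k : Fin (finrank K L)) :
    naturalOrderMatrix θ γ x ⟨(k + j) % finrank K L, Nat.mod_lt _ finrank_pos⟩ j =
      algebraMap (𝓞 K) (𝓞 L) γ ^ ((k + j : ℕ) / finrank K L) *
        (θ ^ (j : ℕ)) • naturalOrderCoeff θ γ x k :=
  naturalOrderMatrix_apply θ γ x _ j k rfl

theorem exists_eq_add_mod {d : ℕ} (i j : Fin d) : ∃ k : Fin d, (i : ℕ) = (k + j) % d := by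
  have hd : 0 < d := i.pos
  refine ⟨⟨(i + (d - j)) % d, Nat.mod_lt _ hd⟩, ?_⟩
  have : (i : ℕ) + (d - j) + j = i + d := by omega
  rw [Nat.mod_add_mod, this, Nat.add_mod_right, Nat.mod_eq_of_lt i.2]

/-- At a prime not dividing `γ`, reduction of the left regular representation modulo a prime of
`𝓞_L`. -/
theorem exists_reduction_of_notMem (hθ : ∀ σ : L ≃ₐ[K] L, σ ∈ Subgroup.zpowers θ)
    {𝔮 : Ideal (𝓞 K)} [h𝔮 : 𝔮.IsMaximal] (hγ : γ ∉ 𝔮) (P : Ideal (𝓞 L)) [P.IsMaximal]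
    (hP : P.under (𝓞 K) = 𝔮) (x : naturalOrder θ γ)
    (hx : ∀ i j, naturalOrderMatrix θ γ x i j ∈ P) :
    ∃ N : ℕ, ∀ i j, (naturalOrderMatrix θ γ x ^ N) i j ∈
      𝔮.map (algebraMap (𝓞 K) (𝓞 L)) := by
  have hγP : algebraMap (𝓞 K) (𝓞 L) γ ∉ P := fun h => hγ (by rw [← hP]; exact h)
  -- Write `σ = θ^m`. Column `m mod d` contains `σ` of the `k`-th coordinate times a power of `γ`,
  -- which can be cancelled modulo `P`.
  have h1 : ∀ (σ : L ≃ₐ[K] L) k, σ • naturalOrderCoeff θ γ x k ∈ P := by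
    intro σ k
    obtain ⟨m, rfl⟩ := (mem_powers_iff_mem_zpowers).2 (hθ σ)
    have hm : (θ ^ (m % finrank K L)) • naturalOrderCoeff θ γ x k =
        (θ ^ m) • naturalOrderCoeff θ γ x k :=
      RingOfIntegers.coe_injective (CyclicAlgebra.pow_mod_apply θ m _)
    have h2 := hx _ _ |> (naturalOrderMatrix_apply_add θ γ x
      ⟨m % finrank K L, Nat.mod_lt _ finrank_pos⟩ k ▸ ·)
    rw [hm] at h2
    exact (Ideal.IsPrime.mem_or_mem inferInstance h2).resolve_left
      fun h => hγP (Ideal.IsPrime.mem_of_pow_mem inferInstance _ h)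
  obtain ⟨N, hN⟩ := Ideal.exists_radical_pow_le_of_fg (𝔮.map (algebraMap (𝓞 K) (𝓞 L)))
    (IsNoetherian.noetherian _)
  refine ⟨N, fun i j => hN (Matrix.pow_apply_mem_pow (fun i j => ?_) N i j)⟩
  obtain ⟨k, hk⟩ := exists_eq_add_mod i j
  rw [naturalOrderMatrix_apply θ γ x i j k hk]
  refine Ideal.mul_mem_left _ _ (mem_radical_map_of_forall_smul_mem hP fun σ => ?_)
  rw [← mul_smul]
  exact h1 _ _

/-- Above the diagonal the exponent `k + j` has wrapped past `d`, so the entry carries a factor `γ`.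
-/
theorem naturalOrderMatrix_apply_mem_of_lt {𝔮 : Ideal (𝓞 K)} (hγ : γ ∈ 𝔮)
    (x : naturalOrder θ γ) {i j : Fin (finrank K L)} (hij : i < j) :
    naturalOrderMatrix θ γ x i j ∈ 𝔮.map (algebraMap (𝓞 K) (𝓞 L)) := by
  obtain ⟨k, hk⟩ := exists_eq_add_mod i j
  rw [naturalOrderMatrix_apply θ γ x i j k hk]
  refine Ideal.mul_mem_right _ _ (Ideal.pow_mem_of_mem _ (Ideal.mem_map_of_mem _ hγ) _ ?_)
  refine Nat.div_pos ?_ finrank_pos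
  by_contra! h
  rw [Nat.mod_eq_of_lt h] at hk
  have : (i : ℕ) < j := hij
  omega

/-- At a prime dividing `γ`, reduction of the constant coordinate modulo `𝔮 𝓞_L`. -/
noncomputable def naturalOrderConstCoeff {𝔮 : Ideal (𝓞 K)} (hγ : γ ∈ 𝔮) :
    naturalOrder θ γ →+* 𝓞 L ⧸ 𝔮.map (algebraMap (𝓞 K) (𝓞 L)) where
  toFun x := Ideal.Quotient.mk _ (naturalOrderMatrix θ γ x ⟨0, finrank_pos⟩ ⟨0, finrank_pos⟩)
  map_one' := by rw [map_one, Matrix.one_apply_eq, map_one]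
  map_zero' := by rw [map_zero, Matrix.zero_apply, map_zero]
  map_add' x y := by rw [map_add, Matrix.add_apply, map_add]
  map_mul' x y := by
    rw [map_mul, Matrix.mul_apply, map_sum, Finset.sum_eq_single ⟨0, finrank_pos⟩, map_mul]
    · intro k _ hk
      rw [Ideal.Quotient.eq_zero_iff_mem]
      refine Ideal.mul_mem_right _ _ (naturalOrderMatrix_apply_mem_of_lt θ γ hγ x ?_)
      exact Nat.pos_of_ne_zero fun h => hk (Fin.ext h)
    · simp

/-- Modulo `𝔮 𝓞_L` the matrix is lower triangular, and its diagonal consists of conjugates of the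
constant coordinate, hence vanishes. -/
theorem naturalOrderMatrix_pow_mem_of_constCoeff_eq_zero {𝔮 : Ideal (𝓞 K)} (hγ : γ ∈ 𝔮)
    (x : naturalOrder θ γ) (hx : naturalOrderConstCoeff θ γ hγ x = 0) :
    ∀ i j, (naturalOrderMatrix θ γ x ^ finrank K L) i j ∈ 𝔮.map (algebraMap (𝓞 K) (𝓞 L)) := by
  have h0 := Ideal.Quotient.eq_zero_iff_mem.1 hx
  have hdiag : ∀ j : Fin (finrank K L), naturalOrderMatrix θ γ x j j =
      (θ ^ (j : ℕ)) • naturalOrderCoeff θ γ x ⟨0, finrank_pos⟩ := fun j => by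
    rw [naturalOrderMatrix_apply θ γ x j j ⟨0, finrank_pos⟩
      (by simp [Nat.mod_eq_of_lt j.2]), zero_add, Nat.div_eq_of_lt j.2, pow_zero, one_mul]
  rw [hdiag, pow_zero, one_smul] at h0
  have h1 := Matrix.pow_card_eq_zero_of_strictly_lower
    (A := (Ideal.Quotient.mk (𝔮.map (algebraMap (𝓞 K) (𝓞 L)))).mapMatrix
      (naturalOrderMatrix θ γ x)) fun i j hij => ?_
  · rw [← map_pow] at h1
    intro i j
    exact Ideal.Quotient.eq_zero_iff_mem.1
      (congrArg (fun A : Matrix _ _ (𝓞 L ⧸ 𝔮.map (algebraMap (𝓞 K) (𝓞 L))) => A i j) h1)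
  · rw [RingHom.mapMatrix_apply, Matrix.map_apply, Ideal.Quotient.eq_zero_iff_mem]
    rcases hij.lt_or_eq with h | rfl
    · exact naturalOrderMatrix_apply_mem_of_lt θ γ hγ x h
    · rw [hdiag]
      exact smul_mem_map_of_mem 𝔮 _ h0

end Reduction

/-! ### The idempotent width of `Λ_q` and the conclusion. -/

/-- This algebra has dimension `[L : K]` over `𝓞_K / 𝔮`, whatever the ramification, and acts
faithfully on itself. -/
theorem idempotentWidthLE_quotient_map {K L : Type*} [Field K] [NumberField K] [Field L]
    [NumberField L] [Algebra K L] [FiniteDimensional K L] (𝔮 : Ideal (𝓞 K)) [𝔮.IsMaximal] :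
    IdempotentWidthLE (𝓞 L ⧸ 𝔮.map (algebraMap (𝓞 K) (𝓞 L))) (finrank K L) := by
  let := Ideal.Quotient.field 𝔮
  have hfr := Ideal.finrank_quotient_map (S := 𝓞 L) 𝔮 K L
  have : Module.Finite (𝓞 K ⧸ 𝔮) (𝓞 L ⧸ 𝔮.map (algebraMap (𝓞 K) (𝓞 L))) :=
    Module.finite_of_finrank_pos (hfr ▸ finrank_pos)
  have h := idempotentWidthLE_end (𝓞 K ⧸ 𝔮) (𝓞 L ⧸ 𝔮.map (algebraMap (𝓞 K) (𝓞 L)))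
  rw [hfr] at h
  exact h.of_injective (Algebra.lmul (𝓞 K ⧸ 𝔮) _).toRingHom Algebra.lmul_injective

theorem idempotentWidthLE_matrix (F : Type*) [Field F] (d : ℕ) :
    IdempotentWidthLE (Matrix (Fin d) (Fin d) F) d := by
  have h := idempotentWidthLE_end F (Fin d → F)
  rw [finrank_fin_fun] at h
  exact h.of_injective (Matrix.toLinAlgEquiv' (R := F) (n := Fin d)).toRingEquiv.toRingHom
    (Matrix.toLinAlgEquiv' (R := F) (n := Fin d)).injective


/-- For each maximal ideal `𝔮` of `𝓞_K`, the natural order maps to a ring of idempotent width at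
most `d`, with kernel nilpotent modulo `𝔮`. -/
theorem exists_reduction {K L : Type*} [Field K] [NumberField K] [Field L] [NumberField L]
    [Algebra K L] [FiniteDimensional K L] [IsGalois K L] (θ : L ≃ₐ[K] L) (γ : 𝓞 K)
    (hθ : ∀ σ : L ≃ₐ[K] L, σ ∈ Subgroup.zpowers θ) (𝔮 : Ideal (𝓞 K)) [h𝔮 : 𝔮.IsMaximal]
    {q : ℕ} (hq : (q : 𝓞 K) ∈ 𝔮) :
    ∃ (I : Ideal (naturalOrder θ γ)) (_ : I.IsTwoSided),
      IdempotentWidthLE (naturalOrder θ γ ⧸ I) (finrank K L) ∧ (q : naturalOrder θ γ) ∈ I ∧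
        ∀ x ∈ I, ∃ N : ℕ, ∀ i j, (naturalOrderMatrix θ γ x ^ N) i j ∈
          𝔮.map (algebraMap (𝓞 K) (𝓞 L)) := by
  by_cases hγ : γ ∈ 𝔮
  · refine ⟨RingHom.ker (naturalOrderConstCoeff θ γ hγ), inferInstance,
      (idempotentWidthLE_quotient_map 𝔮).of_injective _ (RingHom.kerLift_injective _), ?_,
      fun x hx => ⟨_, naturalOrderMatrix_pow_mem_of_constCoeff_eq_zero θ γ hγ x hx⟩⟩
    rw [RingHom.mem_ker, map_natCast, ← map_natCast (Ideal.Quotient.mk _),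
      Ideal.Quotient.eq_zero_iff_mem, ← map_natCast (algebraMap (𝓞 K) (𝓞 L))]
    exact Ideal.mem_map_of_mem _ hq
  · obtain ⟨P, hPm, hP⟩ := Ideal.exists_maximal_ideal_liesOver_of_isIntegral (S := 𝓞 L) 𝔮
    let := Ideal.Quotient.field P
    let φ := (Ideal.Quotient.mk P).mapMatrix.comp (naturalOrderMatrix θ γ)
    refine ⟨RingHom.ker φ, inferInstance,
      (idempotentWidthLE_matrix (𝓞 L ⧸ P) (finrank K L)).of_injective _
        (RingHom.kerLift_injective _), ?_,
      fun x hx => exists_reduction_of_notMem θ γ hθ hγ P hP.over.symm x fun i j => ?_⟩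
    · have h : (q : 𝓞 L ⧸ P) = 0 := by
        rw [← map_natCast (Ideal.Quotient.mk _), Ideal.Quotient.eq_zero_iff_mem,
          ← map_natCast (algebraMap (𝓞 K) (𝓞 L))]
        have := hP.over ▸ hq
        exact this
      rw [RingHom.mem_ker, map_natCast]
      ext i j
      rw [Matrix.natCast_apply]
      split_ifs <;> simp [h]
    · exact Ideal.Quotient.eq_zero_iff_mem.1
        (congrArg (fun A : Matrix _ _ (𝓞 L ⧸ P) => A i j) (RingHom.mem_ker.1 hx))

theorem idempotentWidthLE_naturalOrderQuotient {K L : Type*} [Field K] [NumberField K] [Field L]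
    [NumberField L] [Algebra K L] [FiniteDimensional K L] [IsGalois K L] (θ : L ≃ₐ[K] L)
    (γ : 𝓞 K) (hθ : ∀ σ : L ≃ₐ[K] L, σ ∈ Subgroup.zpowers θ) {q : ℕ} (hq : q ≠ 0)
    (hsplit : SplitsCompletely K q) :
    IdempotentWidthLE (NaturalOrderQuotient θ γ q) (finrank ℚ K * finrank K L) := by
  obtain ⟨𝔮, -, hprime, hprod⟩ := hsplit
  have hq𝔮 : ∀ k, (q : 𝓞 K) ∈ 𝔮 k := fun k => by
    have h : Ideal.span {(q : 𝓞 K)} ≤ 𝔮 k :=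
      hprod.trans_le (Ideal.prod_le_inf.trans (Finset.inf_le (Finset.mem_univ k)))
    exact h (Ideal.mem_span_singleton_self _)
  have hmax : ∀ k, (𝔮 k).IsMaximal := fun k =>
    (hprime k).isMaximal fun h => hq (by simpa [h] using hq𝔮 k)
  choose I hI hwidth hqI hnil using fun k => exists_reduction θ γ hθ (𝔮 k) (hq𝔮 k)
  have hle : ∀ k, naturalOrderIdeal θ γ q ≤ I k := fun k =>
    (Ideal.span_singleton_le_iff_mem _).2 (hqI k)
  have h := IdempotentWidthLE.of_ringHom hwidth (fun k => Ideal.Quotient.factor (hle k)) ?_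
  · simpa using h
  intro x hx
  obtain ⟨x, rfl⟩ := Ideal.Quotient.mk_surjective x
  choose N hN using fun k => hnil k x (Ideal.Quotient.eq_zero_iff_mem.1 (hx k))
  refine ⟨∑ k, N k, ?_⟩
  rw [← map_pow, Ideal.Quotient.eq_zero_iff_mem]
  refine mem_naturalOrderIdeal θ γ fun i j => ?_
  -- Adding the exponents multiplies the ideals, and `∏ 𝔮_k 𝓞_L = q 𝓞_L`.
  have h1 := Matrix.pow_sum_apply_mem_prod Finset.univ (fun k _ => hN k) i j
  have hmap := map_prod (Ideal.mapHom (algebraMap (𝓞 K) (𝓞 L))) 𝔮 Finset.univ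
  simp only [Ideal.mapHom_apply] at hmap
  rw [← map_pow, ← hmap, ← hprod, Ideal.map_span] at h1
  simpa using h1

theorem mainTheorem9 {K L : Type*} [Field K] [NumberField K] [Field L] [Algebra K L]
    [FiniteDimensional K L] [IsGalois K L]
    (θ : L ≃ₐ[K] L) (hθ : ∀ σ : L ≃ₐ[K] L, σ ∈ Subgroup.zpowers θ)
    (γ : 𝓞 K) (hγ : γ ≠ 0)
    (q : ℕ) (hq : q.Prime) (hsplit : SplitsCompletely K q) (hqn : finrank ℚ K + 1 ≤ q) :
    Finite (NaturalOrderQuotient θ γ q) ∧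
      Real.exp (-(finrank K L : ℝ)) ≤
        (Nat.card {x : NaturalOrderQuotient θ γ q // IsUnit x} : ℝ) /
          (Nat.card (NaturalOrderQuotient θ γ q) : ℝ) := by
  have : NumberField L := NumberField.of_module_finite K L
  have hfin := finite_naturalOrderQuotient θ γ hq.ne_zero
  refine ⟨hfin, ?_⟩
  have h0 : (q : NaturalOrderQuotient θ γ q) = 0 := by
    rw [← map_natCast (Ideal.Quotient.mk (naturalOrderIdeal θ γ q)),
      Ideal.Quotient.eq_zero_iff_mem]
    exact Ideal.mem_span_singleton_self _
  have h := pow_mul_card_le_card_isUnit hq h0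
    (idempotentWidthLE_naturalOrderQuotient θ γ hθ hq.ne_zero hsplit)
  rw [le_div_iff₀ (Nat.cast_pos.2 Nat.card_pos)]
  exact (mul_le_mul_of_nonneg_right (exp_neg_le_pow hq.two_le hqn) (Nat.cast_nonneg _)).trans h
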